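/- Let $n=2m+1$ with $m\ge 2$, let $p$ be an odd prime with $(n,p)\ne(5,3)$, and let $(V,q)$ be a non-degenerate quadratic space of dimension $n$ over $\mathbb{F}_p$, with $(x|y)=q(x+y)-q(x)-q(y)$. Let $\mathrm{GO}(V)$ and $\mathrm{SO}(V)$ be its orthogonal group and special orthogonal group. If $g\in\mathrm{GO}(V)$ is a product $r_{v_1}\cdots r_{v_k}$ of reflections $r_v(x)=x-(v|x)v/q(v)$ (with $q(v_i)\neq 0$), its spinor norm is $1$ if $q(v_1)\cdots q(v_k)$ is a square in $\mathbb{F}_p^\times$ and $-1$ otherwise. Let $\Omega(V)$ be the kernel of the spinor norm on $\mathrm{SO}(V)$, and put $$P(V)=\Omega(V)\cup(-1)\,\Omega(V),\qquad Q(V)=\Omega(V)\cup(-\sigma)\,\Omega(V),$$ where $\sigma\in\mathrm{SO}(V)\setminus\Omega(V)$; these are subgroups of $\mathrm{GO}(V)$ and $Q(V)$ does not depend on $\sigma$. For $V$ of odd dimension $n$ these groups are written $\mathrm{SO}_n(p)$, $P_n(p)$ and $Q_n(p)$; up to isomorphism they depend only on $n$ and $p$. Let $G$ be one of the subgroups $\mathrm{SO}_n(p)$,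 $P_n(p)$, $Q_n(p)$ of $\mathrm{GO}(V)$, and let $v_0\in V$ be a singular vector, i.e. $v_0\ne 0$ and $q(v_0)=0$. Suppose that $\operatorname{Stab}_G v_0\cong p^{n-2}.P_{n-2}(p)$, that is, $\operatorname{Stab}_G v_0$ has a normal subgroup which is elementary abelian of order $p^{n-2}$ and whose quotient is isomorphic to $P_{n-2}(p)$. Then $$G=\begin{cases}P_n(p) & \text{if } p\equiv 1 \bmod 4,\\ Q_n(p) & \text{if } p\equiv 3 \bmod 4.\end{cases}$$ -/

import Mathlib

/-! Subgroups of the orthogonal group of a quadratic space `(V, Q)` over a field `F`, all of them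
realised inside the group `V ≃ₗ[F] V` of linear automorphisms. The bilinear form of the space is
`(x | y) = Q (x + y) - Q x - Q y`, that is `QuadraticMap.polar Q x y`. -/

namespace OrthSub

section Defs

variable {F : Type*} [Field F] {V : Type*} [AddCommGroup V] [Module F V]

/-- A singular vector of a quadratic space: a nonzero vector on which the form vanishes. -/
def IsSingular (Q : QuadraticForm F V) (v : V) : Prop := v ≠ 0 ∧ Q v = 0

/-- The orthogonal group `GO(V)`. -/
def GO (Q : QuadraticForm F V) : Subgroup (V ≃ₗ[F] V) where
  carrier := {g | ∀ x, Q (g x) = Q x}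
  mul_mem' := by
    intro a b ha hb x
    exact (ha (b x)).trans (hb x)
  one_mem' := fun _ => rfl
  inv_mem' := by
    intro a ha x
    have h := ha (a⁻¹ x)
    rw [← h]
    congr 1
    exact a.apply_symm_apply x

/-- The special orthogonal group `SO(V)`. -/
noncomputable def SO (Q : QuadraticForm F V) : Subgroup (V ≃ₗ[F] V) :=
  GO Q ⊓ (LinearEquiv.det : (V ≃ₗ[F] V) →* Fˣ).ker

/-- The reflection `r_v : x ↦ x - (v | x) v / Q v` in a vector `v` with `Q v ≠ 0`. -/
noncomputable def refl (Q : QuadraticForm F V) (v : V) : V →ₗ[F] V :=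
  LinearMap.id - (Q v)⁻¹ • (QuadraticMap.polarBilin Q v).smulRight v

/-- `g` is the product `r_{v_1} r_{v_2} ⋯ r_{v_k}` of the reflections in the entries of the list
`l = [v_1, …, v_k]` of non-singular nonzero vectors. -/
def IsReflProd (Q : QuadraticForm F V) (g : V ≃ₗ[F] V) (l : List V) : Prop :=
  (∀ v ∈ l, Q v ≠ 0) ∧ (g : V →ₗ[F] V) = (l.map (refl Q)).prod

open Classical in
/-- The spinor norm of `g`: it is `1` if `g = r_{v_1} ⋯ r_{v_k}` with `Q v_1 ⋯ Q v_k` a square,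
and `-1` otherwise. -/
noncomputable def spinorNorm (Q : QuadraticForm F V) (g : V ≃ₗ[F] V) : ℤˣ :=
  if ∃ l : List V, IsReflProd Q g l ∧ IsSquare (l.map Q).prod then 1 else -1

variable {Q : QuadraticForm F V}

theorem spinorNorm_eq_one_iff {g : V ≃ₗ[F] V} :
    spinorNorm Q g = 1 ↔ ∃ l : List V, IsReflProd Q g l ∧ IsSquare (l.map Q).prod := by
  unfold spinorNorm
  split_ifs with h
  · simp [h]
  · simp only [h, iff_false]
    decide

theorem refl_apply (v x : V) :
    refl Q v x = x - ((Q v)⁻¹ * QuadraticMap.polar Q v x) • v := by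
  simp [refl, smul_smul]

theorem refl_refl {v : V} (hv : Q v ≠ 0) : refl Q v * refl Q v = 1 := by
  ext x
  have h : QuadraticMap.polar Q v v = 2 * Q v := by
    simp [QuadraticMap.polar_self]
  simp only [Module.End.mul_apply, refl_apply, QuadraticMap.polar_sub_right,
    QuadraticMap.polar_smul_right, h, Module.End.one_apply, smul_eq_mul]
  rw [sub_sub, ← add_smul]
  convert sub_zero x
  convert zero_smul F v
  field_simp
  ring

theorem map_refl {v : V} (hv : Q v ≠ 0) (x : V) : Q (refl Q v x) = Q x := by
  rw [refl_apply, sub_eq_add_neg, ← neg_smul, QuadraticMap.map_add Q, QuadraticMap.map_smul,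
    QuadraticMap.polar_smul_right, QuadraticMap.polar_comm Q x v]
  simp only [smul_eq_mul]
  field_simp
  ring

theorem IsReflProd.nil : IsReflProd Q (1 : V ≃ₗ[F] V) [] := ⟨by simp, rfl⟩

theorem IsReflProd.mul {g h : V ≃ₗ[F] V} {l k : List V} (hg : IsReflProd Q g l)
    (hh : IsReflProd Q h k) : IsReflProd Q (g * h) (l ++ k) := by
  refine ⟨?_, ?_⟩
  · intro v hv
    rcases List.mem_append.1 hv with h1 | h1
    · exact hg.1 v h1
    · exact hh.1 v h1
  · rw [List.map_append, List.prod_append, ← hg.2, ← hh.2]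
    rfl

theorem prod_refl_reverse {l : List V} (hl : ∀ v ∈ l, Q v ≠ 0) :
    (l.reverse.map (refl Q)).prod * (l.map (refl Q)).prod = 1 := by
  induction l with
  | nil => simp
  | cons a l ih =>
    simp only [List.mem_cons, forall_eq_or_imp] at hl
    simp only [List.reverse_cons, List.map_append, List.map_cons, List.map_nil, List.prod_append,
      List.prod_cons, List.prod_nil, mul_one]
    rw [mul_assoc, ← mul_assoc (refl Q a), refl_refl hl.1, one_mul, ih hl.2]

theorem IsReflProd.inv {g : V ≃ₗ[F] V} {l : List V} (hg : IsReflProd Q g l) :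
    IsReflProd Q g⁻¹ l.reverse := by
  refine ⟨fun v hv => hg.1 v (List.mem_reverse.1 hv), ?_⟩
  have h := prod_refl_reverse hg.1
  rw [← hg.2] at h
  have h2 : (g : V →ₗ[F] V) * ((g⁻¹ : V ≃ₗ[F] V) : V →ₗ[F] V) = 1 := by
    ext x
    exact g.apply_symm_apply x
  exact (left_inv_eq_right_inv h h2).symm

/-- `Ω(V)`: the kernel of the spinor norm on `SO(V)`. -/
noncomputable def Omega (Q : QuadraticForm F V) : Subgroup (V ≃ₗ[F] V) where
  carrier := {g | g ∈ SO Q ∧ spinorNorm Q g = 1}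
  mul_mem' := by
    rintro a b ⟨ha, ha'⟩ ⟨hb, hb'⟩
    refine ⟨mul_mem ha hb, ?_⟩
    rw [spinorNorm_eq_one_iff] at *
    obtain ⟨l, hl, hs⟩ := ha'
    obtain ⟨k, hk, ht⟩ := hb'
    exact ⟨l ++ k, hl.mul hk, by rw [List.map_append, List.prod_append]; exact hs.mul ht⟩
  one_mem' := ⟨one_mem _, spinorNorm_eq_one_iff.2 ⟨[], IsReflProd.nil, by simp⟩⟩
  inv_mem' := by
    rintro a ⟨ha, ha'⟩
    refine ⟨inv_mem ha, ?_⟩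
    rw [spinorNorm_eq_one_iff] at *
    obtain ⟨l, hl, hs⟩ := ha'
    refine ⟨l.reverse, hl.inv, ?_⟩
    rwa [List.map_reverse, List.prod_reverse]

variable (F V) in
/-- The automorphism `-1 : x ↦ -x`. -/
def negOne : V ≃ₗ[F] V := LinearEquiv.neg F

theorem negOne_mul_self : negOne F V * negOne F V = 1 := by
  ext x
  exact neg_neg x

theorem negOne_comm (g : V ≃ₗ[F] V) : negOne F V * g = g * negOne F V := by
  ext x
  exact (map_neg g x).symm

/-- `P(V) = Ω(V) ∪ (-1) Ω(V)`. -/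
noncomputable def PSub (Q : QuadraticForm F V) : Subgroup (V ≃ₗ[F] V) where
  carrier := {g | g ∈ Omega Q ∨ ∃ w ∈ Omega Q, g = negOne F V * w}
  mul_mem' := by
    rintro a b (ha | ⟨w, hw, rfl⟩) (hb | ⟨u, hu, rfl⟩)
    · exact Or.inl (mul_mem ha hb)
    · exact Or.inr ⟨a * u, mul_mem ha hu, by rw [← mul_assoc, ← negOne_comm, mul_assoc]⟩
    · exact Or.inr ⟨w * b, mul_mem hw hb, by rw [mul_assoc]⟩
    · refine Or.inl ?_
      rw [negOne_comm w, mul_assoc, ← mul_assoc (negOne F V) (negOne F V), negOne_mul_self, one_mul]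
      exact mul_mem hw hu
  one_mem' := Or.inl (one_mem _)
  inv_mem' := by
    rintro a (ha | ⟨w, hw, rfl⟩)
    · exact Or.inl (inv_mem ha)
    · refine Or.inr ⟨w⁻¹, inv_mem hw, ?_⟩
      rw [mul_inv_rev, negOne_comm, inv_eq_of_mul_eq_one_left negOne_mul_self]

/-- `Q(V)`: the subgroup `Ω(V) ∪ (-σ) Ω(V)` for `σ ∈ SO(V) \ Ω(V)`. It is written here as the
subgroup generated by these sets for all such `σ`; by `coe_QSub` below it is equal, as a set, to
`Ω(V) ∪ (-σ) Ω(V)` for every single choice of `σ`. -/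
noncomputable def QSub (q : QuadraticForm F V) : Subgroup (V ≃ₗ[F] V) :=
  Subgroup.closure
    {g | g ∈ Omega q ∨ ∃ s ∈ SO q, s ∉ Omega q ∧ ∃ w ∈ Omega q, g = (negOne F V * s) * w}

end Defs

section Lemmas

variable {F : Type*} [Field F] {V : Type*} [AddCommGroup V] [Module F V]
  {q : QuadraticForm F V}

theorem polar_GO {g : V ≃ₗ[F] V} (hg : g ∈ GO q) (x y : V) :
    QuadraticMap.polar q (g x) (g y) = QuadraticMap.polar q x y := by
  simp only [QuadraticMap.polar, ← map_add]
  rw [hg (x + y), hg x, hg y]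

/-- The reflection in `v` as an element of the orthogonal group. -/
noncomputable def reflEquiv (v : V) (hv : q v ≠ 0) : V ≃ₗ[F] V :=
  LinearEquiv.ofLinearMap (refl q v) (refl q v) (refl_refl hv) (refl_refl hv)

theorem reflEquiv_mem {v : V} (hv : q v ≠ 0) : reflEquiv v hv ∈ GO q := map_refl hv

theorem isReflProd_reflEquiv {v : V} (hv : q v ≠ 0) : IsReflProd q (reflEquiv v hv) [v] :=
  ⟨by simpa using hv, by ext x; simp [reflEquiv]⟩

theorem refl_of_polar_eq_zero {v x : V} (h : QuadraticMap.polar q v x = 0) :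
    refl q v x = x := by
  rw [refl_apply, h]; simp

/-- `r_{v - w}` exchanges two vectors of the same value. -/
theorem refl_sub {v w : V} (h : q v = q w) (hv : q (v - w) ≠ 0) : refl q (v - w) v = w := by
  have e : QuadraticMap.polar q (v - w) v = q (v - w) := by
    rw [QuadraticMap.polar_sub_left]
    have h1 : QuadraticMap.polar q v v = 2 * q v := by simp [QuadraticMap.polar_self]
    have h2 : q (v - w) = q v + q w - QuadraticMap.polar q v w := by
      rw [sub_eq_add_neg, QuadraticMap.map_add q, QuadraticMap.map_neg, QuadraticMap.polar_neg_right]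
      ring
    rw [h1, h2, QuadraticMap.polar_comm q w v, ← h]
    ring
  rw [refl_apply, e, inv_mul_cancel₀ hv, one_smul, sub_sub_cancel]

/-- The orthogonal group is generated by reflections. -/
theorem exists_isReflProd [FiniteDimensional F V] (hq : q.Nondegenerate) (h2 : (2 : F) ≠ 0)
    {g : V ≃ₗ[F] V} (hg : g ∈ GO q) : ∃ l, IsReflProd q g l := by
  have : Invertible (2 : F) := invertibleOfNonzero h2
  have hnd : (QuadraticMap.polarBilin q).Nondegenerate := by
    rw [QuadraticMap.nondegenerate_polar_iff]
    exact hq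
  have hsymm : LinearMap.IsSymm (QuadraticMap.polarBilin q) :=
    ⟨fun x y => QuadraticMap.polar_comm q x y⟩
  obtain ⟨b, hb⟩ := LinearMap.BilinForm.exists_orthogonal_basis hsymm
  have hbne : ∀ i, q (b i) ≠ 0 := by
    intro i h0
    refine hb.not_isOrtho_basis_self_of_separatingLeft hnd.1 i ?_
    show QuadraticMap.polar q (b i) (b i) = 0
    rw [QuadraticMap.polar_self, h0]; simp
  have hbo : ∀ i j, i ≠ j → QuadraticMap.polar q (b i) (b j) = 0 := fun i j hij => hb hij
  -- downward induction on the number of basis vectors that are fixed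
  have key : ∀ d k : ℕ, k + d = Module.finrank F V → ∀ g : V ≃ₗ[F] V, g ∈ GO q →
      (∀ i, i.1 < k → g (b i) = b i) → ∃ l, IsReflProd q g l := by
    intro d
    induction d with
    | zero =>
      intro k hk g _ hfix
      have : g = 1 := by
        apply LinearEquiv.toLinearMap_injective
        refine b.ext fun i => ?_
        exact hfix i (by have := i.2; omega)
      exact ⟨[], this ▸ IsReflProd.nil⟩
    | succ d ih =>
      intro k hk g hg hfix
      let j : Fin (Module.finrank F V) := ⟨k, by omega⟩
      have hqj : q (g (b j)) = q (b j) := hg _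
      have horth : ∀ i : Fin (Module.finrank F V), i.1 < k →
          QuadraticMap.polar q (g (b j)) (b i) = 0 ∧ QuadraticMap.polar q (b j) (b i) = 0 := by
        intro i hi
        have hne : j ≠ i := fun h => by rw [← h] at hi; exact lt_irrefl _ hi
        refine ⟨?_, hbo _ _ hne⟩
        have := polar_GO hg (b j) (b i)
        rw [hfix i hi, hbo _ _ hne] at this
        exact this
      have step : ∀ r : V ≃ₗ[F] V, r ∈ GO q → (∃ l, IsReflProd q r l) →
          (∀ i, i.1 < k → r (b i) = b i) → r (g (b j)) = b j → ∃ l, IsReflProd q g l := by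
        rintro r hr ⟨l, hl⟩ hrf hrj
        obtain ⟨l', hl'⟩ := ih (k + 1) (by omega) (r * g) (mul_mem hr hg) (by
          intro i hi
          show r (g (b i)) = b i
          rcases Nat.lt_succ_iff_lt_or_eq.1 hi with h | h
          · rw [hfix i h, hrf i h]
          · have : i = j := Fin.ext h
            rw [this, hrj])
        have := hl.inv.mul hl'
        rw [inv_mul_cancel_left] at this
        exact ⟨_, this⟩
      by_cases hm : q (g (b j) - b j) = 0
      · have hp : q (g (b j) - -b j) ≠ 0 := by
          intro h
          have e1 := QuadraticMap.map_add q (g (b j)) (b j)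
          have e2 := QuadraticMap.map_add q (g (b j)) (-b j)
          rw [QuadraticMap.map_neg, QuadraticMap.polar_neg_right, ← sub_eq_add_neg, hm] at e2
          rw [sub_neg_eq_add] at h
          rw [h] at e1
          have : (2 * 2) * q (b j) = 0 := by linear_combination (-1) * e1 - e2 - 2 * hqj
          exact hbne j ((mul_eq_zero.1 this).resolve_left (mul_ne_zero h2 h2))
        refine step (reflEquiv (b j) (hbne j) * reflEquiv _ hp)
          (mul_mem (reflEquiv_mem _) (reflEquiv_mem _))
          ⟨_, (isReflProd_reflEquiv _).mul (isReflProd_reflEquiv _)⟩ ?_ ?_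
        · intro i hi
          show refl q (b j) (refl q _ (b i)) = b i
          rw [refl_of_polar_eq_zero (x := b i) (v := g (b j) - -b j),
            refl_of_polar_eq_zero (horth i hi).2]
          rw [sub_neg_eq_add, QuadraticMap.polar_add_left, (horth i hi).1, (horth i hi).2, add_zero]
        · show refl q (b j) (refl q _ (g (b j))) = b j
          rw [refl_sub (by rw [QuadraticMap.map_neg, hqj]) hp, map_neg, refl_apply,
            QuadraticMap.polar_self]
          have : (q (b j))⁻¹ * (2 • q (b j)) = 2 := by
            rw [nsmul_eq_mul]; field_simp [hbne j]; norm_num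
          rw [this, two_smul]
          abel
      · refine step (reflEquiv _ hm) (reflEquiv_mem _) ⟨_, isReflProd_reflEquiv _⟩ ?_ ?_
        · intro i hi
          show refl q _ (b i) = b i
          rw [refl_of_polar_eq_zero]
          rw [QuadraticMap.polar_sub_left, (horth i hi).1, (horth i hi).2, sub_zero]
        · exact refl_sub hqj hm
  exact key (Module.finrank F V) 0 (by omega) g hg (fun i hi => absurd hi (Nat.not_lt_zero _))

/-- The product of two elements of `SO(V) \ Ω(V)` lies in `Ω(V)`. -/
theorem mul_mem_Omega [Finite F] [FiniteDimensional F V] (hq : q.Nondegenerate) (h2 : (2 : F) ≠ 0)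
    {s t : V ≃ₗ[F] V} (hs : s ∈ SO q) (hs' : s ∉ Omega q) (ht : t ∈ SO q) (ht' : t ∉ Omega q) :
    s * t ∈ Omega q := by
  classical
  have := Fintype.ofFinite F
  obtain ⟨l, hl⟩ := exists_isReflProd hq h2 hs.1
  obtain ⟨k, hk⟩ := exists_isReflProd hq h2 ht.1
  have h1 : ¬ IsSquare (l.map q).prod := fun h =>
    hs' ⟨hs, spinorNorm_eq_one_iff.2 ⟨l, hl, h⟩⟩
  have h3 : ¬ IsSquare (k.map q).prod := fun h =>
    ht' ⟨ht, spinorNorm_eq_one_iff.2 ⟨k, hk, h⟩⟩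
  refine ⟨mul_mem hs ht, spinorNorm_eq_one_iff.2 ⟨l ++ k, hl.mul hk, ?_⟩⟩
  rw [List.map_append, List.prod_append]
  have n1 : (l.map q).prod ≠ 0 := fun h => h1 (h ▸ IsSquare.zero)
  have n3 : (k.map q).prod ≠ 0 := fun h => h3 (h ▸ IsSquare.zero)
  rw [← quadraticChar_one_iff_isSquare (mul_ne_zero n1 n3), map_mul,
    quadraticChar_neg_one_iff_not_isSquare.2 h1, quadraticChar_neg_one_iff_not_isSquare.2 h3]
  norm_num

theorem Omega_le_SO : Omega q ≤ SO q := fun _ h => h.1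

/-- For every `s ∈ SO(V) \ Ω(V)` the set `Ω(V) ∪ (-s) Ω(V)` is the subgroup `Q(V)`. -/
theorem coe_QSub [Finite F] [FiniteDimensional F V] (hq : q.Nondegenerate) (h2 : (2 : F) ≠ 0)
    {s : V ≃ₗ[F] V} (hs : s ∈ SO q) (hs' : s ∉ Omega q) :
    (QSub q : Set (V ≃ₗ[F] V)) =
      {g | g ∈ Omega q ∨ ∃ w ∈ Omega q, g = (negOne F V * s) * w} := by
  have hnot : ∀ {t w : V ≃ₗ[F] V}, t ∉ Omega q → w ∈ Omega q → t * w ∉ Omega q :=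
    fun ht hw h => ht ((Subgroup.mul_mem_cancel_right _ hw).1 h)
  have hnot' : ∀ {t w : V ≃ₗ[F] V}, t ∉ Omega q → w ∈ Omega q → w * t ∉ Omega q :=
    fun ht hw h => ht ((Subgroup.mul_mem_cancel_left _ hw).1 h)
  have hmem : ∀ {t : V ≃ₗ[F] V}, t ∈ SO q → t ∉ Omega q →
      ∃ w ∈ Omega q, negOne F V * t = (negOne F V * s) * w := by
    intro t ht ht'
    refine ⟨s⁻¹ * t, mul_mem_Omega hq h2 (inv_mem hs) (fun h => hs' ?_) ht ht', by group⟩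
    simpa using inv_mem h
  let K : Subgroup (V ≃ₗ[F] V) :=
    { carrier := {g | g ∈ Omega q ∨ ∃ w ∈ Omega q, g = (negOne F V * s) * w}
      one_mem' := Or.inl (one_mem _)
      mul_mem' := by
        rintro a b (ha | ⟨w, hw, rfl⟩) (hb | ⟨u, hu, rfl⟩)
        · exact Or.inl (mul_mem ha hb)
        · refine Or.inr ?_
          obtain ⟨x, hx, e⟩ := hmem (mul_mem (Omega_le_SO ha) (mul_mem hs (Omega_le_SO hu)))
            (hnot' (hnot hs' hu) ha)
          refine ⟨x, hx, ?_⟩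
          rw [← e, ← mul_assoc, ← mul_assoc, ← negOne_comm]
          simp only [mul_assoc]
        · exact Or.inr ⟨w * b, mul_mem hw hb, by rw [mul_assoc]⟩
        · refine Or.inl ?_
          have e : negOne F V * s * w * (negOne F V * s * u) = (s * w) * (s * u) := by
            rw [mul_assoc, mul_assoc, mul_assoc (negOne F V) s u, ← mul_assoc w, ← negOne_comm,
              mul_assoc (negOne F V) w, ← mul_assoc s, ← negOne_comm s, mul_assoc, ← mul_assoc,
              negOne_mul_self, one_mul, ← mul_assoc]
          rw [e]
          exact mul_mem_Omega hq h2 (mul_mem hs (Omega_le_SO hw)) (hnot hs' hw)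
            (mul_mem hs (Omega_le_SO hu)) (hnot hs' hu)
      inv_mem' := by
        rintro a (ha | ⟨w, hw, rfl⟩)
        · exact Or.inl (inv_mem ha)
        · refine Or.inr ?_
          obtain ⟨x, hx, e⟩ := hmem (inv_mem (mul_mem hs (Omega_le_SO hw)))
            (fun h => hnot hs' hw (by simpa using inv_mem h))
          refine ⟨x, hx, ?_⟩
          rw [← e, mul_assoc, mul_inv_rev, inv_eq_of_mul_eq_one_left negOne_mul_self,
            negOne_comm] }
  have hK : QSub q = K := by
    apply le_antisymm
    · refine (Subgroup.closure_le _).2 ?_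
      rintro g (hg | ⟨t, ht, ht', w, hw, rfl⟩)
      · exact Or.inl hg
      · obtain ⟨x, hx, e⟩ := hmem ht ht'
        exact Or.inr ⟨x * w, mul_mem hx hw, by rw [e, mul_assoc]⟩
    · rintro g (hg | ⟨w, hw, rfl⟩)
      · exact Subgroup.subset_closure (Or.inl hg)
      · exact Subgroup.subset_closure (Or.inr ⟨s, hs, hs', w, hw, rfl⟩)
  rw [hK]
  rfl

end Lemmas

end OrthSub

/-! The group $P_{n-2}(p)$ contains the central involution $-1$. Since the kernel of
$\operatorname{Stab}_G v_0 \to P_{n-2}(p)$ has odd exponent $p$, this involution lifts to an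
involution $s \in \operatorname{Stab}_G v_0$ all of whose commutators have $p$-th power $1$
(`exists_involution_of_groupExtension`). The theorem follows by determining what such an $s$ can be.

Let $V_+$ and $V_-$ be the eigenspaces of $s$; they are orthogonal and non-degenerate, and $v_0 \in
V_+$, so $\dim V_+ \ge 2$. If $\dim V_+ > 2$, there are $b \in V_+ \cap v_0^\perp$ and $a \in V_-$
with $q(a) = q(b) \ne 0$. A product of two reflections, one of them in $b + a$, lies in $\Omega(V)$,
fixes $v_0$, and has commutator $r_{b-a} r_{b+a}$ with $s$: a nontrivial involution, which is
impossible as $p$ is odd (`exists_commutator_of_involution`). So $V_+$ is a plane. Containing a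
singular vector it is hyperbolic, and $-s = r_e r_f$ for an orthogonal basis $e, f$ of $V_+$ with
$q(e) q(f) \in -(\mathbb{F}_p^\times)^2$ (`exists_negOne_mul_eq_of_finrank_eq_two`). As $n$ is odd,
$\det s = -1$, which excludes $\mathrm{SO}_n(p)$. Whether $-1$ is a square decides whether $-s \in
\Omega(V)$, hence whether $G$ is $P$ or $Q$.

The last step for $p \equiv 3$ needs $r_e r_f \notin \Omega(V)$, although the spinor norm is defined
by the existence of some factorisation. The needed invariant is the signature of the permutation of
a quadric $q = c$, $c \ne 0$: it is trivial on $\Omega(V)$ (`quadricSign_of_mem_Omega`), but equals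
$-1$ on $r_x r_y$ when $x \perp y$ and $q(x) q(y)$ is a nonsquare
(`quadricSign_mul_of_not_isSquare`). -/

namespace OrthSub

/-! ### Reflections: conjugation, determinant and products of two -/

section Reflections

variable {F : Type*} [Field F] {V : Type*} [AddCommGroup V] [Module F V]
  {q : QuadraticForm F V}

@[simp] theorem reflEquiv_apply {v : V} (hv : q v ≠ 0) (x : V) :
    reflEquiv v hv x = refl q v x := rfl

theorem reflEquiv_congr {v w : V} (h : v = w) (hv : q v ≠ 0) (hw : q w ≠ 0) :
    reflEquiv v hv = reflEquiv w hw := by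
  subst h; rfl

theorem reflEquiv_mul_self {v : V} (hv : q v ≠ 0) : reflEquiv v hv * reflEquiv v hv = 1 := by
  ext x
  exact LinearMap.congr_fun (refl_refl hv) x

theorem reflEquiv_inv {v : V} (hv : q v ≠ 0) : (reflEquiv v hv)⁻¹ = reflEquiv v hv :=
  inv_eq_of_mul_eq_one_left (reflEquiv_mul_self hv)

theorem refl_smul {c : F} (hc : c ≠ 0) (v : V) : refl q (c • v) = refl q v := by
  ext x
  simp only [refl_apply, QuadraticMap.map_smul, QuadraticMap.polar_smul_left, smul_smul,
    smul_eq_mul]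
  congr 2
  field_simp

theorem refl_neg (v : V) : refl q (-v) = refl q v := by
  have := refl_smul (q := q) (neg_ne_zero.2 (one_ne_zero (α := F))) v
  rwa [neg_one_smul] at this

theorem refl_self {v : V} (hv : q v ≠ 0) : refl q v v = -v := by
  rw [refl_apply, QuadraticMap.polar_self, nsmul_eq_mul, Nat.cast_ofNat, mul_left_comm,
    inv_mul_cancel₀ hv, mul_one, two_smul]
  abel

theorem conj_reflEquiv {g : V ≃ₗ[F] V} (hg : g ∈ GO q) {v : V} (hv : q v ≠ 0)
    (hv' : q (g v) ≠ 0) : g * reflEquiv v hv * g⁻¹ = reflEquiv (g v) hv' := by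
  ext x
  obtain ⟨y, rfl⟩ := g.surjective x
  have e : g⁻¹ (g y) = y := g.symm_apply_apply y
  simp only [LinearEquiv.mul_apply, reflEquiv_apply, e, refl_apply, map_sub, map_smul,
    polar_GO hg, hg v]

theorem det_refl [FiniteDimensional F V] {v : V} (hv : q v ≠ 0) :
    LinearMap.det (refl q v) = -1 := by
  -- The functional takes the value $-2$ at $v$, so the determinant is $1 - 2$.
  have h : refl q v = LinearMap.transvection (-((q v)⁻¹ • QuadraticMap.polarBilin q v)) v := by
    ext x
    simp [refl_apply, LinearMap.transvection.apply, sub_eq_add_neg]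
  rw [h, LinearMap.transvection.det]
  simp only [LinearMap.neg_apply, LinearMap.smul_apply, QuadraticMap.polarBilin_apply_apply,
    QuadraticMap.polar_self, smul_eq_mul, nsmul_eq_mul]
  field_simp
  norm_num

theorem det_prod_refl [FiniteDimensional F V] {l : List V} (hl : ∀ v ∈ l, q v ≠ 0) :
    LinearMap.det (l.map (refl q)).prod = (-1) ^ l.length := by
  induction l with
  | nil => simp
  | cons a l ih =>
    simp only [List.mem_cons, forall_eq_or_imp] at hl
    rw [List.map_cons, List.prod_cons, map_mul, det_refl hl.1, ih hl.2, List.length_cons, pow_succ']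

theorem mem_SO_iff {g : V ≃ₗ[F] V} :
    g ∈ SO q ↔ g ∈ GO q ∧ LinearMap.det (g : V →ₗ[F] V) = 1 := by
  rw [SO, Subgroup.mem_inf, MonoidHom.mem_ker, Units.ext_iff, LinearEquiv.coe_det, Units.val_one]

theorem reflEquiv_mul_reflEquiv_mem_SO [FiniteDimensional F V] {v w : V} (hv : q v ≠ 0)
    (hw : q w ≠ 0) : reflEquiv v hv * reflEquiv w hw ∈ SO q := by
  rw [mem_SO_iff]
  refine ⟨mul_mem (reflEquiv_mem hv) (reflEquiv_mem hw), ?_⟩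
  change LinearMap.det (refl q v * refl q w) = 1
  rw [map_mul, det_refl hv, det_refl hw]
  norm_num

theorem reflEquiv_mul_reflEquiv_mem_Omega [FiniteDimensional F V] {v w : V} (hv : q v ≠ 0)
    (hw : q w ≠ 0) (h : IsSquare (q v * q w)) : reflEquiv v hv * reflEquiv w hw ∈ Omega q :=
  ⟨reflEquiv_mul_reflEquiv_mem_SO hv hw, spinorNorm_eq_one_iff.2
    ⟨_, (isReflProd_reflEquiv hv).mul (isReflProd_reflEquiv hw), by simpa using h⟩⟩

/-- Vectors of the same nonzero value are exchanged up to sign by a reflection. -/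
theorem exists_mem_GO_map_eq_or_eq_neg (h2 : (2 : F) ≠ 0) {x y : V} (hx : q x ≠ 0)
    (h : q x = q y) : ∃ g ∈ GO q, g x = y ∨ g x = -y := by
  by_cases hm : q (x - y) = 0
  -- Parallelogram law: $q(x-y)$ and $q(x+y)$ add up to $4 q(x) \ne 0$, so they cannot both vanish.
  · have hp : q (x - -y) ≠ 0 := by
      intro hp
      have e1 := QuadraticMap.map_add q x y
      have e2 := QuadraticMap.map_add q x (-y)
      rw [QuadraticMap.map_neg, QuadraticMap.polar_neg_right, ← sub_eq_add_neg, hm] at e2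
      rw [sub_neg_eq_add] at hp
      rw [hp] at e1
      have : (2 * 2) * q x = 0 := by linear_combination (-1) * e1 - e2 + 2 * h
      exact hx ((mul_eq_zero.1 this).resolve_left (mul_ne_zero h2 h2))
    exact ⟨_, reflEquiv_mem hp, Or.inr (refl_sub (by rw [QuadraticMap.map_neg, h]) hp)⟩
  · exact ⟨_, reflEquiv_mem hm, Or.inl (refl_sub h hm)⟩

end Reflections

/-! ### Signature of the orthogonal group acting on a quadric -/

section Sign

variable {F : Type*} [Field F] {V : Type*} [AddCommGroup V] [Module F V]

/-- The action of the orthogonal group on the quadric `q = c`. -/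
def quadricPerm (q : QuadraticForm F V) (c : F) : GO q →* Equiv.Perm {v : V // q v = c} where
  toFun g := Equiv.Perm.subtypePerm (p := fun v => q v = c) g.1.toEquiv fun v => by
    change q (g.1 v) = c ↔ q v = c
    rw [g.2 v]
  map_one' := by ext v; rfl
  map_mul' g h := by ext v; rfl

theorem ringChar_ne_two (h2 : (2 : F) ≠ 0) : ringChar F ≠ 2 := fun h =>
  h2 (by simpa [h] using ringChar.Nat.cast_ringChar (R := F))

/-- The equations `a t² = s` and `b t² = s` have two solutions together if `a b` is not a
square. -/
theorem card_mul_sq_add_card_mul_sq [Fintype F] [DecidableEq F] (h2 : (2 : F) ≠ 0) {a b : F} (hab : ¬ IsSquare (a * b))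
    (s : F) : (Finset.univ.filter fun t : F => t ^ 2 * a = s).card +
      (Finset.univ.filter fun t : F => t ^ 2 * b = s).card = 2 := by
  have ha : a ≠ 0 := by rintro rfl; simp at hab
  have hb : b ≠ 0 := by rintro rfl; simp at hab
  -- The number of square roots of $s/d$ is $1 + \chi(s/d)$; for $d = a, b$ the characters are
  -- opposite and cancel in the sum.
  have key : ∀ d : F, d ≠ 0 → ((Finset.univ.filter fun t : F => t ^ 2 * d = s).card : ℤ) =
      quadraticChar F s * quadraticChar F d + 1 := by
    intro d hd
    have e := quadraticChar_card_sqrts (ringChar_ne_two h2) (s / d)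
    have e1 : quadraticChar F (s / d) = quadraticChar F s * quadraticChar F d := by
      have : s * d = s / d * d ^ 2 := by field_simp
      rw [← map_mul, this, map_mul, quadraticChar_sq_one' hd, mul_one]
    rw [← e1, ← e]
    congr 2
    ext t
    simp [eq_div_iff hd]
  have h1 := quadraticChar_neg_one_iff_not_isSquare.2 hab
  rw [map_mul] at h1
  have h3 : quadraticChar F a + quadraticChar F b = 0 := by
    rcases quadraticChar_dichotomy ha with h | h <;> rw [h] at h1 ⊢ <;> linarith
  have : ((Finset.univ.filter fun t : F => t ^ 2 * a = s).card +
      (Finset.univ.filter fun t : F => t ^ 2 * b = s).card : ℤ) = 2 := by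
    rw [key a ha, key b hb]
    linear_combination quadraticChar F s * h3
  exact_mod_cast this

theorem even_card_of_neg_mem (h2 : (2 : F) ≠ 0) (s : Finset V) (h0 : (0 : V) ∉ s)
    (hs : ∀ v ∈ s, -v ∈ s) : Even s.card := by
  have hz : ∑ _v ∈ s, (1 : ZMod 2) = 0 := by
    refine Finset.sum_involution (fun v _ => -v) (fun _ _ => by decide) ?_ hs
      (fun _ _ => neg_neg _)
    intro v hv _ h
    have h' : (2 : F) • v = 0 := by rw [two_smul]; nth_rewrite 1 [← h]; exact neg_add_cancel v
    exact h0 ((smul_eq_zero.1 h').resolve_left h2 ▸ hv)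
  rw [Finset.sum_const, nsmul_eq_mul, mul_one] at hz
  exact (ZMod.natCast_eq_zero_iff_even).1 hz

variable {q : QuadraticForm F V}

variable (q) in
/-- The vectors orthogonal to both `x` and `y`. -/
def orthPair (x y : V) : Submodule F V :=
  LinearMap.ker (QuadraticMap.polarBilin q x) ⊓ LinearMap.ker (QuadraticMap.polarBilin q y)

theorem mem_orthPair {x y v : V} :
    v ∈ orthPair q x y ↔ QuadraticMap.polar q x v = 0 ∧ QuadraticMap.polar q y v = 0 := by
  simp [orthPair]

variable [Fintype V] [DecidableEq F]

variable (q) in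
/-- The hyperplane section of the quadric `q = c` by the orthogonal complement of `x`. -/
def quadricSection (c : F) (x : V) : Finset V :=
  Finset.univ.filter fun v => q v = c ∧ QuadraticMap.polar q x v = 0

theorem mem_quadricSection {c : F} {x v : V} :
    v ∈ quadricSection q c x ↔ q v = c ∧ QuadraticMap.polar q x v = 0 := by
  simp [quadricSection]

theorem even_card_quadricSection (h2 : (2 : F) ≠ 0) {c : F} (hc : c ≠ 0) (x : V) :
    Even (quadricSection q c x).card := by
  refine even_card_of_neg_mem h2 _ ?_ ?_
  · rw [mem_quadricSection, QuadraticMap.map_zero]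
    exact fun h => hc h.1.symm
  · intro v
    simp only [mem_quadricSection, QuadraticMap.map_neg, QuadraticMap.polar_neg_right,
      neg_eq_zero, imp_self]

theorem card_quadricSection_le (c : F) (x : V) :
    (quadricSection q c x).card ≤ Fintype.card {v : V // q v = c} := by
  rw [Fintype.card_subtype]
  refine Finset.card_le_card fun v hv => ?_
  simpa using (mem_quadricSection.1 hv).1

theorem even_card_quadric (h2 : (2 : F) ≠ 0) {c : F} (hc : c ≠ 0) :
    Even (Fintype.card {v : V // q v = c}) := by
  rw [Fintype.card_subtype]
  refine even_card_of_neg_mem h2 _ ?_ ?_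
  · simpa using fun h => hc h.symm
  · simp

/-- Points of the section are written as $w + t y$ with $w$ orthogonal to $x$ and $y$, and are
counted fibrewise over $w$. The coordinate $t$ is recovered by pairing with $y$. -/
theorem card_quadricSection [Fintype F] (h2 : (2 : F) ≠ 0) {x y : V} (hy : q y ≠ 0)
    (hxy : QuadraticMap.polar q x y = 0) (c : F)
    (E : Finset V) (hE : ∀ v, v ∈ E ↔ v ∈ orthPair q x y) :
    (quadricSection q c x).card =
      ∑ w ∈ E, (Finset.univ.filter fun t : F => t ^ 2 * q y = c - q w).card := by
  rw [← Finset.card_sigma]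
  have hp : ∀ t : F, ∀ w ∈ E, q (w + t • y) = q w + t ^ 2 * q y := by
    intro t w hw
    rw [QuadraticMap.map_add q, QuadraticMap.map_smul, QuadraticMap.polar_smul_right,
      QuadraticMap.polar_comm, (mem_orthPair.1 ((hE w).1 hw)).2, smul_eq_mul, smul_zero, add_zero,
      sq]
  have hyy : ∀ t : F, ∀ w ∈ E, QuadraticMap.polar q y (w + t • y) = 2 * t * q y := by
    intro t w hw
    rw [QuadraticMap.polar_add_right, (mem_orthPair.1 ((hE w).1 hw)).2,
      QuadraticMap.polar_smul_right, QuadraticMap.polar_self, smul_eq_mul, nsmul_eq_mul]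
    push_cast
    ring
  symm
  refine Finset.card_bij (fun s _ => s.1 + s.2 • y) ?_ ?_ ?_
  · rintro ⟨w, t⟩ h
    simp only [Finset.mem_sigma, Finset.mem_filter, Finset.mem_univ, true_and] at h
    rw [mem_quadricSection, hp t w h.1, h.2, QuadraticMap.polar_add_right,
      (mem_orthPair.1 ((hE w).1 h.1)).1, QuadraticMap.polar_smul_right, hxy]
    simp
  · rintro ⟨w, t⟩ h ⟨w', t'⟩ h' e
    simp only [Finset.mem_sigma, Finset.mem_filter, Finset.mem_univ, true_and] at h h' e
    have e1 := hyy t w h.1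
    rw [e, hyy t' w' h'.1] at e1
    have e2 : t' = t := mul_left_cancel₀ h2 (mul_right_cancel₀ hy e1)
    subst e2
    rw [add_right_cancel e]
  · intro v hv
    rw [mem_quadricSection] at hv
    set t := QuadraticMap.polar q y v / (2 * q y) with ht
    have hw : v - t • y ∈ E := by
      rw [hE, mem_orthPair, QuadraticMap.polar_sub_right, QuadraticMap.polar_sub_right,
        QuadraticMap.polar_smul_right, QuadraticMap.polar_smul_right, hxy, hv.2,
        QuadraticMap.polar_self, nsmul_eq_mul, ht]
      refine ⟨by simp, ?_⟩
      simp only [smul_eq_mul, Nat.cast_ofNat]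
      field_simp
      ring
    refine ⟨⟨v - t • y, t⟩, ?_, sub_add_cancel _ _⟩
    simp only [Finset.mem_sigma, Finset.mem_filter, Finset.mem_univ, true_and]
    refine ⟨hw, ?_⟩
    have := hp t _ hw
    rw [sub_add_cancel, hv.1] at this
    linear_combination -this

variable [DecidableEq V]

variable (q) in
/-- The signature of the action of the orthogonal group on the quadric `q = c`. -/
def quadricSign (c : F) : GO q →* ℤˣ :=
  Equiv.Perm.sign.comp (quadricPerm q c)

theorem card_fixedPoints_quadricPerm {c : F} {x : V} (hx : q x ≠ 0) :
    Fintype.card (Function.fixedPoints (quadricPerm q c ⟨_, reflEquiv_mem hx⟩)) =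
      (quadricSection q c x).card := by
  have h : ∀ v : V, refl q x v = v ↔ QuadraticMap.polar q x v = 0 := by
    intro v
    rw [refl_apply, sub_eq_self, smul_eq_zero, mul_eq_zero, inv_eq_zero]
    have : x ≠ 0 := fun h => hx (by rw [h, QuadraticMap.map_zero])
    tauto
  rw [← Fintype.card_coe]
  refine Fintype.card_congr
    { toFun := fun v => ⟨v.1.1, mem_quadricSection.2
        ⟨v.1.2, (h _).1 (congrArg Subtype.val v.2)⟩⟩
      invFun := fun v => ⟨⟨v.1, (mem_quadricSection.1 v.2).1⟩,
        Subtype.ext ((h _).2 (mem_quadricSection.1 v.2).2)⟩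
      left_inv := fun _ => rfl
      right_inv := fun _ => rfl }

theorem quadricSign_reflEquiv {c : F} {x : V} (hx : q x ≠ 0) :
    quadricSign q c ⟨_, reflEquiv_mem hx⟩ =
      (-1) ^ ((Fintype.card {v : V // q v = c} - (quadricSection q c x).card) / 2) := by
  have h : quadricPerm q c ⟨_, reflEquiv_mem hx⟩ ^ 2 = 1 := by
    rw [← map_pow, ← map_one (quadricPerm q c)]
    exact congrArg _ (Subtype.ext ((sq _).trans (reflEquiv_mul_self hx)))
  rw [quadricSign, MonoidHom.comp_apply, Equiv.Perm.sign_of_pow_two_eq_one h,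
    card_fixedPoints_quadricPerm hx]

/-- After rescaling $y$, which does not change its reflection, $q(x) = q(y)$. The two reflections
are then conjugate in $\mathrm{GO}(V)$, and the signature takes values in an abelian group. -/
theorem quadricSign_eq_of_isSquare (h2 : (2 : F) ≠ 0) (c : F) {x y : V}
    (hx : q x ≠ 0) (hy : q y ≠ 0) (hs : IsSquare (q x * q y)) :
    quadricSign q c ⟨_, reflEquiv_mem hx⟩ = quadricSign q c ⟨_, reflEquiv_mem hy⟩ := by
  obtain ⟨r, hr⟩ := hs
  have hr0 : r ≠ 0 := by
    rintro rfl
    exact mul_ne_zero hx hy (by simpa using hr)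
  have ht : r / q y ≠ 0 := div_ne_zero hr0 hy
  have hq : q x = q ((r / q y) • y) := by
    rw [QuadraticMap.map_smul, smul_eq_mul]
    field_simp
    linear_combination hr
  obtain ⟨g, hg, hgx⟩ := exists_mem_GO_map_eq_or_eq_neg h2 hx hq
  have hgx' : q (g x) ≠ 0 := by rwa [hg x]
  have e : g * reflEquiv x hx * g⁻¹ = reflEquiv y hy := by
    rw [conj_reflEquiv hg hx hgx']
    ext v
    rcases hgx with h | h <;> simp [h, refl_neg, refl_smul ht]
  have e' : (⟨g, hg⟩ * ⟨_, reflEquiv_mem hx⟩ * ⟨g, hg⟩⁻¹ : GO q) = ⟨_, reflEquiv_mem hy⟩ :=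
    Subtype.ext e
  rw [← e', map_mul, map_mul, map_inv, mul_right_comm, mul_inv_cancel, one_mul]

variable [Fintype F]

/-- A reflection moves the points off its hyperplane section in pairs, so its signature is read off
from the size of the section. Over each $w \perp x, y$ the two sections together have exactly two
points, and the number of such $w$ is odd. -/
theorem quadricSign_mul_of_not_isSquare (h2 : (2 : F) ≠ 0) {c : F} (hc : c ≠ 0) {x y : V}
    (hx : q x ≠ 0) (hy : q y ≠ 0) (hxy : QuadraticMap.polar q x y = 0)
    (hs : ¬ IsSquare (q x * q y)) :
    quadricSign q c ⟨_, reflEquiv_mem hx⟩ * quadricSign q c ⟨_, reflEquiv_mem hy⟩ = -1 := by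
  classical
  let E : Finset V := Finset.univ.filter fun v => v ∈ orthPair q x y
  have hE : ∀ v, v ∈ E ↔ v ∈ orthPair q x y := by simp [E]
  have hsum : (quadricSection q c x).card + (quadricSection q c y).card = 2 * E.card := by
    rw [card_quadricSection h2 hy hxy c E hE, card_quadricSection h2 hx
      (by rw [QuadraticMap.polar_comm, hxy]) c E (fun v => by
        rw [hE, mem_orthPair, mem_orthPair, and_comm]), ← Finset.sum_add_distrib,
      Finset.sum_congr rfl fun w _ => card_mul_sq_add_card_mul_sq h2
        (by rwa [mul_comm]) (c - q w), Finset.sum_const, smul_eq_mul, mul_comm]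
  have hodd : Odd E.card := by
    have e1 : E.card = Nat.card (orthPair q x y) := by
      rw [Nat.card_eq_fintype_card, Fintype.card_subtype]
    rw [e1, Module.natCard_eq_pow_finrank (K := F), Nat.card_eq_fintype_card]
    exact (Nat.odd_iff.2 (FiniteField.odd_card_of_char_ne_two (ringChar_ne_two h2))).pow
  rw [quadricSign_reflEquiv, quadricSign_reflEquiv, ← pow_add]
  -- With $N$ points on the quadric, the exponent is $N - |E|$, where $N$ is even and $|E|$, a power
  -- of $|F|$, is odd.
  refine Odd.neg_one_pow ?_
  have a1 := card_quadricSection_le (q := q) c x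
  have a2 := card_quadricSection_le (q := q) c y
  obtain ⟨k1, h1⟩ := even_card_quadricSection (q := q) h2 hc x
  obtain ⟨k2, h3⟩ := even_card_quadricSection (q := q) h2 hc y
  obtain ⟨k, hk⟩ := even_card_quadric (q := q) h2 hc
  obtain ⟨j, hj⟩ := hodd
  rw [Nat.odd_iff]
  omega

end Sign

/-! ### Anisotropic vectors and values represented on subspaces -/

section Subspaces

variable {F : Type*} [Field F] {V : Type*} [AddCommGroup V] [Module F V]
  {q : QuadraticForm F V}

theorem eq_zero_of_polar_eq_zero (hq : q.Nondegenerate) (h2 : (2 : F) ≠ 0) {u : V}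
    (h : ∀ w, QuadraticMap.polar q u w = 0) : u = 0 := by
  have : Invertible (2 : F) := invertibleOfNonzero h2
  exact (QuadraticMap.nondegenerate_polar_iff.2 hq).1 u h

/-- If $q$ vanished on $U$, so would its polar form, and $U$ would be its own radical. The subspace
$R$ is any bound for the radical; it is used with $0$ and with the line of $v_0$. -/
theorem exists_mem_anisotropic {U R : Submodule F V}
    (hR : ∀ u ∈ U, (∀ w ∈ U, QuadraticMap.polar q u w = 0) → u ∈ R) (hU : ¬ U ≤ R) :
    ∃ b ∈ U, q b ≠ 0 := by
  by_contra! h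
  refine hU fun u hu => hR u hu fun w hw => ?_
  simp [QuadraticMap.polar, h _ hu, h _ hw, h _ (add_mem hu hw)]

theorem finrank_le_finrank_inf_ker_add_one [FiniteDimensional F V] (U : Submodule F V)
    (f : V →ₗ[F] F) :
    Module.finrank F U ≤ Module.finrank F (U ⊓ LinearMap.ker f : Submodule F V) + 1 := by
  have h1 := Submodule.finrank_sup_add_finrank_inf_eq U (LinearMap.ker f)
  have h2 := LinearMap.finrank_range_add_finrank_ker f
  have h3 := Submodule.finrank_le (LinearMap.range f)
  have h4 := Submodule.finrank_le (U ⊔ LinearMap.ker f)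
  rw [Module.finrank_self] at h3
  omega

/-- A vector of `U` splits along an anisotropic vector of `U`. -/
theorem sub_smul_mem_inf_ker (h2 : (2 : F) ≠ 0) {U : Submodule F V} {b w : V} (hb : b ∈ U)
    (hw : w ∈ U) (hqb : q b ≠ 0) :
    w - (QuadraticMap.polar q b w / (2 * q b)) • b ∈
      U ⊓ LinearMap.ker (QuadraticMap.polarBilin q b) := by
  refine ⟨sub_mem hw (U.smul_mem _ hb), ?_⟩
  simp only [SetLike.mem_coe, LinearMap.mem_ker, QuadraticMap.polarBilin_apply_apply,
    QuadraticMap.polar_sub_right, QuadraticMap.polar_smul_right, QuadraticMap.polar_self,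
    smul_eq_mul, nsmul_eq_mul, Nat.cast_ofNat]
  field_simp
  ring

/-- Splitting off an anisotropic $b$ lowers the dimension by at most one and leaves the radical
inside $R$, so a second anisotropic vector exists in $U \cap b^\perp$. -/
theorem exists_orthogonal_pair [FiniteDimensional F V] (h2 : (2 : F) ≠ 0) {U R : Submodule F V}
    (hR : ∀ u ∈ U, (∀ w ∈ U, QuadraticMap.polar q u w = 0) → u ∈ R)
    (hU : Module.finrank F R + 2 ≤ Module.finrank F U) :
    ∃ e ∈ U, ∃ f ∈ U, q e ≠ 0 ∧ q f ≠ 0 ∧ QuadraticMap.polar q e f = 0 := by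
  obtain ⟨b, hb, hqb⟩ := exists_mem_anisotropic hR fun h => by
    have := Submodule.finrank_mono h
    omega
  have h3 := finrank_le_finrank_inf_ker_add_one U (QuadraticMap.polarBilin q b)
  obtain ⟨f, hf, hqf⟩ := exists_mem_anisotropic (q := q) (R := R)
    (U := U ⊓ LinearMap.ker (QuadraticMap.polarBilin q b)) (by
      intro u hu h
      refine hR u hu.1 fun w hw => ?_
      have e := h _ (sub_smul_mem_inf_ker h2 hb hw hqb)
      have e' : QuadraticMap.polar q b u = 0 := hu.2
      rwa [QuadraticMap.polar_sub_right, QuadraticMap.polar_smul_right,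
        QuadraticMap.polar_comm q u b, e', smul_zero, sub_zero] at e) fun h => by
    have := Submodule.finrank_mono h
    omega
  exact ⟨b, hb, f, hf.1, hqb, hqf, hf.2⟩

/-- A subspace of a quadratic space over a finite field that contains two orthogonal
anisotropic vectors represents every element of the field. -/
theorem exists_mem_map_eq [Finite F] (h2 : (2 : F) ≠ 0) {U : Submodule F V} {e f : V}
    (he : e ∈ U) (hf : f ∈ U) (hqe : q e ≠ 0) (hqf : q f ≠ 0)
    (hef : QuadraticMap.polar q e f = 0) (d : F) : ∃ u ∈ U, q u = d := by
  have := Fintype.ofFinite F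
  -- The equation $q(e) a^2 + q(f) b^2 = d$ is solvable over a finite field of odd order.
  obtain ⟨a, b, hab⟩ := FiniteField.exists_root_sum_quadratic
    (f := Polynomial.C (q e) * Polynomial.X ^ 2 + Polynomial.C 0 * Polynomial.X + Polynomial.C (-d))
    (g := Polynomial.C (q f) * Polynomial.X ^ 2 + Polynomial.C 0 * Polynomial.X + Polynomial.C 0)
    (Polynomial.degree_quadratic hqe) (Polynomial.degree_quadratic hqf)
    (FiniteField.odd_card_of_char_ne_two (ringChar_ne_two h2))
  refine ⟨a • e + b • f, add_mem (U.smul_mem _ he) (U.smul_mem _ hf), ?_⟩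
  rw [QuadraticMap.map_add q, QuadraticMap.map_smul, QuadraticMap.map_smul,
    QuadraticMap.polar_smul_left, QuadraticMap.polar_smul_right, hef]
  simp at hab ⊢
  linear_combination hab

theorem exists_polar_eq_zero_map_eq [Finite F] [FiniteDimensional F V] (hq : q.Nondegenerate)
    (h2 : (2 : F) ≠ 0) (hV : 3 ≤ Module.finrank F V) {x : V} (hx : q x ≠ 0) (d : F) :
    ∃ y, QuadraticMap.polar q x y = 0 ∧ q y = d := by
  have h3 := finrank_le_finrank_inf_ker_add_one ⊤ (QuadraticMap.polarBilin q x)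
  rw [finrank_top] at h3
  obtain ⟨e, he, f, hf, hqe, hqf, hef⟩ := exists_orthogonal_pair (q := q) (R := ⊥) h2
    (U := ⊤ ⊓ LinearMap.ker (QuadraticMap.polarBilin q x)) (by
      intro u hu h
      rw [Submodule.mem_bot]
      refine eq_zero_of_polar_eq_zero hq h2 fun w => ?_
      have e := h _ (sub_smul_mem_inf_ker h2 Submodule.mem_top (w := w) Submodule.mem_top hx)
      have e' : QuadraticMap.polar q x u = 0 := hu.2
      rwa [QuadraticMap.polar_sub_right, QuadraticMap.polar_smul_right,
        QuadraticMap.polar_comm q u x, e', smul_zero, sub_zero] at e) (by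
      rw [finrank_bot]; omega)
  obtain ⟨y, hy, hyd⟩ := exists_mem_map_eq h2 he hf hqe hqf hef d
  exact ⟨y, hy.2, hyd⟩

end Subspaces

/-! ### Triviality of the signature on $\Omega(V)$ -/

section SignOmega

variable {F : Type*} [Field F] {V : Type*} [AddCommGroup V] [Module F V]
  {q : QuadraticForm F V} [Fintype V] [DecidableEq V] [DecidableEq F] [Fintype F]

/-- In the nonsquare case $y$ need not be orthogonal to $x$; it is replaced by some $z \perp x$ with
$q(z) = q(y)$, whose reflection has the same signature. -/
theorem quadricSign_reflEquiv_mul [FiniteDimensional F V] (hq : q.Nondegenerate)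
    (h2 : (2 : F) ≠ 0)
    (hV : 3 ≤ Module.finrank F V) {c : F} (hc : c ≠ 0) {x y : V} (hx : q x ≠ 0) (hy : q y ≠ 0) :
    ((quadricSign q c ⟨_, reflEquiv_mem hx⟩ * quadricSign q c ⟨_, reflEquiv_mem hy⟩ : ℤˣ) : ℤ) =
      quadraticChar F (q x * q y) := by
  by_cases hs : IsSquare (q x * q y)
  · rw [quadricSign_eq_of_isSquare h2 c hx hy hs, Int.units_mul_self,
      (quadraticChar_one_iff_isSquare (mul_ne_zero hx hy)).2 hs, Units.val_one]
  · obtain ⟨z, hxz, hz⟩ := exists_polar_eq_zero_map_eq hq h2 hV hx (q y)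
    have hz' : q z ≠ 0 := by rwa [hz]
    rw [← quadricSign_eq_of_isSquare h2 c hz' hy (by rw [hz]; exact IsSquare.mul_self _),
      quadricSign_mul_of_not_isSquare h2 hc hx hz' hxz (by rwa [hz]),
      quadraticChar_neg_one_iff_not_isSquare.2 hs, Units.val_neg, Units.val_one]

/-- The signature of a single reflection is known only relative to that of a reference reflection
$r_x$, whose contribution disappears for words of even length. -/
theorem quadricSign_of_isReflProd [FiniteDimensional F V] (hq : q.Nondegenerate)
    (h2 : (2 : F) ≠ 0) (hV : 3 ≤ Module.finrank F V) {c : F} (hc : c ≠ 0) {x : V} (hx : q x ≠ 0)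
    (l : List V) (g : GO q) (hl : IsReflProd q g l) :
    (quadricSign q c g : ℤ) = (quadricSign q c ⟨_, reflEquiv_mem hx⟩ : ℤ) ^ l.length *
      (quadraticChar F (q x) ^ l.length * quadraticChar F (l.map q).prod) := by
  induction l generalizing g with
  | nil =>
    have : g = 1 := by
      refine Subtype.ext (LinearEquiv.toLinearMap_injective ?_)
      rw [hl.2]
      rfl
    simp [this]
  | cons a l ih =>
    have ha : q a ≠ 0 := hl.1 a List.mem_cons_self
    let r : GO q := ⟨_, reflEquiv_mem ha⟩
    have hr : r * r = 1 := Subtype.ext (reflEquiv_mul_self ha)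
    have h := ih (r * g) (by
      refine ⟨fun v hv => hl.1 v (List.mem_cons_of_mem _ hv), ?_⟩
      change refl q a * ((g : V ≃ₗ[F] V) : V →ₗ[F] V) = _
      rw [hl.2, List.map_cons, List.prod_cons, ← mul_assoc, refl_refl ha, one_mul])
    have e : g = r * (r * g) := by rw [← mul_assoc, hr, one_mul]
    have h3 := quadricSign_reflEquiv_mul hq h2 hV hc hx ha
    have h4 : (quadricSign q c r : ℤ) =
        quadricSign q c ⟨_, reflEquiv_mem hx⟩ * (quadraticChar F (q x) * quadraticChar F (q a)) := by
      rw [← map_mul, ← h3, ← Units.val_mul, ← mul_assoc, Int.units_mul_self, one_mul]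
    rw [e, map_mul, Units.val_mul, h, h4, List.map_cons, List.prod_cons, List.length_cons, map_mul]
    ring

/-- The elements of `Ω(V)` act on the quadric `q = c` as even permutations. -/
theorem quadricSign_of_mem_Omega [FiniteDimensional F V] (hq : q.Nondegenerate)
    (h2 : (2 : F) ≠ 0) (hV : 3 ≤ Module.finrank F V) {c : F} (hc : c ≠ 0) {g : GO q}
    (hg : (g : V ≃ₗ[F] V) ∈ Omega q) : quadricSign q c g = 1 := by
  obtain ⟨hgS, hgs⟩ := hg
  obtain ⟨l, hl, hs⟩ := spinorNorm_eq_one_iff.1 hgs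
  -- Each reflection has determinant $-1$, and $g$ has determinant $1$.
  have hlen : Even l.length := by
    have h := (mem_SO_iff.1 hgS).2
    rw [hl.2, det_prod_refl hl.1] at h
    by_contra ho
    rw [(Nat.not_even_iff_odd.1 ho).neg_one_pow] at h
    exact h2 (by linear_combination -h)
  have hne : (l.map q).prod ≠ 0 := by
    rw [Ne, List.prod_eq_zero_iff]
    simpa using fun v hv => hl.1 v hv
  obtain ⟨x, -, hx⟩ := exists_mem_anisotropic (q := q) (U := ⊤) (R := ⊥)
    (fun u _ h => (Submodule.mem_bot F).2
      (eq_zero_of_polar_eq_zero hq h2 fun w => h w Submodule.mem_top)) (fun h => by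
      have := Submodule.finrank_mono h
      rw [finrank_top, finrank_bot] at this
      omega)
  have h := quadricSign_of_isReflProd hq h2 hV hc hx l g hl
  obtain ⟨k, hk⟩ := hlen
  rw [hk, ← two_mul, pow_mul, pow_mul, quadraticChar_sq_one hx, one_pow, one_mul,
    (quadraticChar_one_iff_isSquare hne).2 hs, ← Units.val_pow_eq_pow_val, Int.units_sq,
    Units.val_one, one_pow, one_mul] at h
  exact Units.ext h

end SignOmega

/-! ### A product of two reflections outside $\Omega(V)$ -/

section NotMemOmega

variable {F : Type*} [Field F] {V : Type*} [AddCommGroup V] [Module F V]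
  {q : QuadraticForm F V}

theorem reflEquiv_mul_reflEquiv_notMem_Omega [Finite F] [FiniteDimensional F V]
    (hq : q.Nondegenerate) (h2 : (2 : F) ≠ 0) (hV : 3 ≤ Module.finrank F V) {x y : V} (hx : q x ≠ 0) (hy : q y ≠ 0)
    (hxy : QuadraticMap.polar q x y = 0) (hs : ¬ IsSquare (q x * q y)) :
    reflEquiv x hx * reflEquiv y hy ∉ Omega q := by
  classical
  have := Fintype.ofFinite F
  have : Finite V := Module.finite_of_finite F
  have := Fintype.ofFinite V
  intro h
  have h1 := quadricSign_of_mem_Omega hq h2 hV one_ne_zero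
    (g := ⟨_, reflEquiv_mem hx⟩ * ⟨_, reflEquiv_mem hy⟩) h
  rw [map_mul, quadricSign_mul_of_not_isSquare h2 one_ne_zero hx hy hxy hs] at h1
  exact absurd h1 (by decide)

end NotMemOmega

/-! ### Involutions fixing a singular vector -/

section Involutions

variable {F : Type*} [Field F] {V : Type*} [AddCommGroup V] [Module F V]
  {q : QuadraticForm F V}

/-- The vectors fixed by `s`. -/
def fixedSpace (s : V ≃ₗ[F] V) : Submodule F V :=
  LinearMap.ker ((s : V →ₗ[F] V) - LinearMap.id)

/-- The vectors negated by `s`. -/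
def negSpace (s : V ≃ₗ[F] V) : Submodule F V :=
  LinearMap.ker ((s : V →ₗ[F] V) + LinearMap.id)

theorem mem_fixedSpace {s : V ≃ₗ[F] V} {v : V} : v ∈ fixedSpace s ↔ s v = v := by
  simp [fixedSpace, sub_eq_zero]

theorem mem_negSpace {s : V ≃ₗ[F] V} {v : V} : v ∈ negSpace s ↔ s v = -v := by
  simp [negSpace, add_eq_zero_iff_eq_neg]

theorem polar_fixed_neg (h2 : (2 : F) ≠ 0) {s : V ≃ₗ[F] V} (hs : s ∈ GO q) {a b : V}
    (ha : s a = -a) (hb : s b = b) : QuadraticMap.polar q b a = 0 := by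
  have h := polar_GO hs b a
  rw [ha, hb, QuadraticMap.polar_neg_right] at h
  have h' : 2 * QuadraticMap.polar q b a = 0 := by linear_combination -h
  exact (mul_eq_zero.1 h').resolve_left h2

theorem exists_eq_add_of_involution (h2 : (2 : F) ≠ 0) {s : V ≃ₗ[F] V} (hss : s * s = 1) (v : V) :
    ∃ b a, s b = b ∧ s a = -a ∧ v = b + a := by
  have h : s (s v) = v := LinearEquiv.congr_fun hss v
  refine ⟨(2 : F)⁻¹ • (v + s v), (2 : F)⁻¹ • (v - s v), ?_, ?_, ?_⟩
  · rw [map_smul, map_add, h, add_comm]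
  · rw [map_smul, map_sub, h, ← smul_neg, neg_sub]
  · rw [← smul_add, add_add_sub_cancel, ← two_smul F, inv_smul_smul₀ h2]

theorem isCompl_fixedSpace_negSpace (h2 : (2 : F) ≠ 0) {s : V ≃ₗ[F] V} (hss : s * s = 1) :
    IsCompl (fixedSpace s) (negSpace s) := by
  constructor
  · rw [Submodule.disjoint_def]
    intro v h h'
    rw [mem_fixedSpace] at h
    rw [mem_negSpace, h] at h'
    have : (2 : F) • v = 0 := by rw [two_smul]; nth_rewrite 1 [h']; exact neg_add_cancel v
    exact (smul_eq_zero.1 this).resolve_left h2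
  · rw [codisjoint_iff, eq_top_iff]
    intro v _
    obtain ⟨b, a, hb, ha, rfl⟩ := exists_eq_add_of_involution h2 hss v
    exact add_mem (Submodule.mem_sup_left (mem_fixedSpace.2 hb))
      (Submodule.mem_sup_right (mem_negSpace.2 ha))

theorem mem_bot_of_mem_fixedSpace (hq : q.Nondegenerate) (h2 : (2 : F) ≠ 0) {s : V ≃ₗ[F] V}
    (hs : s ∈ GO q) (hss : s * s = 1) (u : V) (hu : u ∈ fixedSpace s)
    (h : ∀ w ∈ fixedSpace s, QuadraticMap.polar q u w = 0) : u ∈ (⊥ : Submodule F V) := by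
  rw [Submodule.mem_bot]
  refine eq_zero_of_polar_eq_zero hq h2 fun w => ?_
  obtain ⟨b, a, hb, ha, rfl⟩ := exists_eq_add_of_involution h2 hss w
  rw [QuadraticMap.polar_add_right, h b (mem_fixedSpace.2 hb),
    polar_fixed_neg h2 hs ha (mem_fixedSpace.1 hu), add_zero]

theorem mem_bot_of_mem_negSpace (hq : q.Nondegenerate) (h2 : (2 : F) ≠ 0) {s : V ≃ₗ[F] V}
    (hs : s ∈ GO q) (hss : s * s = 1) (u : V) (hu : u ∈ negSpace s)
    (h : ∀ w ∈ negSpace s, QuadraticMap.polar q u w = 0) : u ∈ (⊥ : Submodule F V) := by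
  rw [Submodule.mem_bot]
  refine eq_zero_of_polar_eq_zero hq h2 fun w => ?_
  obtain ⟨b, a, hb, ha, rfl⟩ := exists_eq_add_of_involution h2 hss w
  rw [QuadraticMap.polar_add_right, h a (mem_negSpace.2 ha), QuadraticMap.polar_comm,
    polar_fixed_neg h2 hs (mem_negSpace.1 hu) hb, add_zero]

/-- The radical of `V₊ ∩ v₀ᗮ` lies in the line of `v₀`, for `v₀` in the fixed space `V₊`. -/
theorem mem_span_of_mem_fixedSpace_inf (hq : q.Nondegenerate) (h2 : (2 : F) ≠ 0)
    {s : V ≃ₗ[F] V} (hs : s ∈ GO q) (hss : s * s = 1) {v₀ : V} (hv : v₀ ≠ 0) (hsv : s v₀ = v₀)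
    (u : V) (hu : u ∈ fixedSpace s ⊓ LinearMap.ker (QuadraticMap.polarBilin q v₀))
    (h : ∀ w ∈ fixedSpace s ⊓ LinearMap.ker (QuadraticMap.polarBilin q v₀),
      QuadraticMap.polar q u w = 0) : u ∈ Submodule.span F {v₀} := by
  have hsv' := mem_fixedSpace.2 hsv
  obtain ⟨z, hz, hvz⟩ : ∃ z ∈ fixedSpace s, QuadraticMap.polar q v₀ z ≠ 0 := by
    by_contra! h'
    exact hv ((Submodule.mem_bot F).1 (mem_bot_of_mem_fixedSpace hq h2 hs hss v₀ hsv' h'))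
  -- This $c$ makes $u - c v_0$ orthogonal to $z$ as well as to $V_+ \cap v_0^\perp$, hence to all
  -- of $V_+$, which is non-degenerate.
  set c := QuadraticMap.polar q u z / QuadraticMap.polar q v₀ z with hc
  have hcz : c * QuadraticMap.polar q v₀ z = QuadraticMap.polar q u z := div_mul_cancel₀ _ hvz
  have h0 : u - c • v₀ = 0 := by
    refine (Submodule.mem_bot F).1 (mem_bot_of_mem_fixedSpace hq h2 hs hss _
      (sub_mem hu.1 (Submodule.smul_mem _ _ hsv')) fun w hw => ?_)
    have hw' : w - (QuadraticMap.polar q v₀ w / QuadraticMap.polar q v₀ z) • z ∈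
        fixedSpace s ⊓ LinearMap.ker (QuadraticMap.polarBilin q v₀) := by
      refine ⟨sub_mem hw (Submodule.smul_mem _ _ hz), ?_⟩
      simp [QuadraticMap.polar_sub_right, QuadraticMap.polar_smul_right, hvz]
    have e := h _ hw'
    rw [QuadraticMap.polar_sub_right, QuadraticMap.polar_smul_right, ← hcz, smul_eq_mul] at e
    rw [QuadraticMap.polar_sub_left, QuadraticMap.polar_smul_left, smul_eq_mul]
    have e2 : QuadraticMap.polar q v₀ w / QuadraticMap.polar q v₀ z *
        (c * QuadraticMap.polar q v₀ z) = c * QuadraticMap.polar q v₀ w := by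
      field_simp
    rw [e2] at e
    exact e
  rw [sub_eq_zero] at h0
  exact Submodule.mem_span_singleton.2 ⟨c, h0.symm⟩

/-- The fixed space is non-degenerate and contains the singular vector $v_0$, so it is larger than
the line of $v_0$. -/
theorem two_le_finrank_fixedSpace [FiniteDimensional F V] (hq : q.Nondegenerate)
    (h2 : (2 : F) ≠ 0) {s : V ≃ₗ[F] V} (hs : s ∈ GO q) (hss : s * s = 1) {v₀ : V}
    (hv : IsSingular q v₀) (hsv : s v₀ = v₀) : 2 ≤ Module.finrank F (fixedSpace s) := by
  have hsv' := mem_fixedSpace.2 hsv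
  have hle : Submodule.span F {v₀} ≤ fixedSpace s := by
    rwa [Submodule.span_singleton_le_iff_mem]
  have hlt : Submodule.span F {v₀} < fixedSpace s := by
    refine lt_of_le_not_ge hle fun h => hv.1 ((Submodule.mem_bot F).1
      (mem_bot_of_mem_fixedSpace hq h2 hs hss v₀ hsv' fun w hw => ?_))
    obtain ⟨c, rfl⟩ := Submodule.mem_span_singleton.1 (h hw)
    rw [QuadraticMap.polar_smul_right, QuadraticMap.polar_self, hv.2, nsmul_zero, smul_zero]
  have := Submodule.finrank_lt_finrank_of_lt hlt
  rw [finrank_span_singleton hv.1] at this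
  omega

/-- The commutator of the involution `s` with a product of two reflections. -/
theorem exists_commutator_of_vectors [FiniteDimensional F V] (h2 : (2 : F) ≠ 0)
    {s : V ≃ₗ[F] V} (hs : s ∈ GO q) {v₀ a b y : V}
    (hsv : s v₀ = v₀) (ha : s a = -a) (hb : s b = b) (hvb : QuadraticMap.polar q v₀ b = 0)
    (hqb : q b ≠ 0) (hab : q a = q b) (hy : s y = y ∨ s y = -y)
    (hvy : QuadraticMap.polar q v₀ y = 0) (hqy : q y = 2 * q b) :
    ∃ h ∈ Omega q, h v₀ = v₀ ∧ (s * h * s⁻¹ * h⁻¹) * (s * h * s⁻¹ * h⁻¹) = 1 ∧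
      s * h * s⁻¹ * h⁻¹ ≠ 1 := by
  have hba := polar_fixed_neg h2 hs ha hb
  have hqx : q (b + a) = 2 * q b := by rw [QuadraticMap.map_add q, hba, hab]; ring
  have hqx' : q (b - a) = 2 * q b := by
    rw [sub_eq_add_neg, QuadraticMap.map_add q, QuadraticMap.polar_neg_right, hba,
      QuadraticMap.map_neg, hab]
    ring
  have h2b : 2 * q b ≠ 0 := mul_ne_zero h2 hqb
  have hx : q (b + a) ≠ 0 := by rwa [hqx]
  have hx' : q (b - a) ≠ 0 := by rwa [hqx']
  have hy0 : q y ≠ 0 := by rwa [hqy]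
  have hsx : s (b + a) = b - a := by rw [map_add, ha, hb, sub_eq_add_neg]
  have hsx0 : q (s (b + a)) ≠ 0 := by rwa [hs]
  have hsy0 : q (s y) ≠ 0 := by rwa [hs]
  have horth : QuadraticMap.polar q (b - a) (b + a) = 0 := by
    rw [QuadraticMap.polar_sub_left, QuadraticMap.polar_add_right, QuadraticMap.polar_add_right,
      hba, QuadraticMap.polar_comm q a b, hba, QuadraticMap.polar_self, QuadraticMap.polar_self,
      hab]
    ring
  have hvx : QuadraticMap.polar q (b + a) v₀ = 0 := by
    rw [QuadraticMap.polar_comm, QuadraticMap.polar_add_right, hvb,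
      polar_fixed_neg h2 hs ha hsv, add_zero]
  -- The element is $h = r_{b+a} r_y$. The factor $r_y$ commutes with $s$, so it drops out of the
  -- commutator; it only serves to bring $h$ into $\Omega(V)$, as $q(b+a) q(y) = (2 q(b))^2$.
  set rx := reflEquiv (b + a) hx with hrx
  set rx' := reflEquiv (b - a) hx' with hrx'
  set ry := reflEquiv y hy0 with hry
  have e1 : s * rx * s⁻¹ = rx' := by
    rw [hrx, conj_reflEquiv hs hx hsx0]
    exact reflEquiv_congr hsx _ _
  have e2 : s * ry * s⁻¹ = ry := by
    rw [hry, conj_reflEquiv hs hy0 hsy0]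
    rcases hy with h | h
    · exact reflEquiv_congr h _ _
    · ext v
      simp [h, refl_neg]
  have hcomm : s * (rx * ry) * s⁻¹ * (rx * ry)⁻¹ = rx' * rx := by
    have : s * (rx * ry) * s⁻¹ * (rx * ry)⁻¹ =
        (s * rx * s⁻¹) * (s * ry * s⁻¹) * ry⁻¹ * rx⁻¹ := by group
    rw [this, e1, e2, mul_inv_cancel_right, hrx, reflEquiv_inv]
  -- Since $q(a) = q(b)$, the vectors $b - a$ and $b + a$ are orthogonal, so their reflections
  -- commute.
  have hcc : rx' * rx = rx * rx' := by
    have hfix : rx' (b + a) = b + a := refl_of_polar_eq_zero horth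
    have h : rx' * rx * rx'⁻¹ = rx := by
      rw [hrx, conj_reflEquiv (reflEquiv_mem hx') hx (by rwa [reflEquiv_mem hx'])]
      exact reflEquiv_congr hfix _ _
    exact mul_inv_eq_iff_eq_mul.1 h
  refine ⟨rx * ry, reflEquiv_mul_reflEquiv_mem_Omega hx hy0 ?_, ?_, ?_, ?_⟩
  · rw [hqx, hqy]
    exact IsSquare.mul_self _
  · change refl q (b + a) (refl q y v₀) = v₀
    rw [refl_of_polar_eq_zero (v := y) (by rw [QuadraticMap.polar_comm, hvy]),
      refl_of_polar_eq_zero hvx]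
  · rw [hcomm]
    nth_rewrite 2 [hcc]
    rw [mul_assoc, ← mul_assoc rx, reflEquiv_mul_self, one_mul, reflEquiv_mul_self]
  · rw [hcomm]
    intro h
    have h3 : rx' (rx (b + a)) = b + a := LinearEquiv.congr_fun h (b + a)
    have h4 : rx (b + a) = -(b + a) := refl_self hx
    have h5 : rx' (b + a) = b + a := refl_of_polar_eq_zero horth
    rw [h4, map_neg, h5] at h3
    have h6 : (2 : F) • (b + a) = 0 := by
      rw [two_smul]; nth_rewrite 1 [← h3]; exact neg_add_cancel _
    rw [(smul_eq_zero.1 h6).resolve_left h2, QuadraticMap.map_zero] at hx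
    exact hx rfl

/-- Vectors $a \in V_-$ and $b \in V_+ \cap v_0^\perp$ of equal nonzero value are needed, with a
third vector $y$ of value $2 q(b)$. One of the two spaces is always large enough to represent every
value: $V_-$ if its dimension is at least $2$, and otherwise $V_+ \cap v_0^\perp$, of dimension at
least $3$ with radical in the line of $v_0$. -/
theorem exists_commutator_of_involution [Finite F] [FiniteDimensional F V]
    (hq : q.Nondegenerate) (h2 : (2 : F) ≠ 0) (hV : 5 ≤ Module.finrank F V) {s : V ≃ₗ[F] V}
    (hs : s ∈ GO q) (hss : s * s = 1) (hs1 : s ≠ 1) {v₀ : V} (hv : IsSingular q v₀)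
    (hsv : s v₀ = v₀) (hfin : Module.finrank F (fixedSpace s) ≠ 2) :
    ∃ h ∈ Omega q, h v₀ = v₀ ∧ (s * h * s⁻¹ * h⁻¹) * (s * h * s⁻¹ * h⁻¹) = 1 ∧
      s * h * s⁻¹ * h⁻¹ ≠ 1 := by
  have hfin2 := two_le_finrank_fixedSpace hq h2 hs hss hv hsv
  have hsum := Submodule.finrank_add_eq_of_isCompl (isCompl_fixedSpace_negSpace h2 hss)
  have hU := finrank_le_finrank_inf_ker_add_one (fixedSpace s) (QuadraticMap.polarBilin q v₀)
  have hrad := mem_span_of_mem_fixedSpace_inf hq h2 hs hss hv.1 hsv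
  have hspan := finrank_span_singleton (K := F) hv.1
  rcases le_or_gt 2 (Module.finrank F (negSpace s)) with hn | hn
  · obtain ⟨e, he, f, hf, hqe, hqf, hef⟩ := exists_orthogonal_pair (q := q) (R := ⊥) h2
      (mem_bot_of_mem_negSpace hq h2 hs hss) (by rwa [finrank_bot, zero_add])
    obtain ⟨b, hb, hqb⟩ := exists_mem_anisotropic hrad fun h => by
      have := Submodule.finrank_mono h
      omega
    obtain ⟨a, ha, hab⟩ := exists_mem_map_eq h2 he hf hqe hqf hef (q b)
    obtain ⟨y, hy, hqy⟩ := exists_mem_map_eq h2 he hf hqe hqf hef (2 * q b)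
    exact exists_commutator_of_vectors h2 hs hsv (mem_negSpace.1 ha) (mem_fixedSpace.1 hb.1) hb.2
      hqb hab (Or.inr (mem_negSpace.1 hy)) (polar_fixed_neg h2 hs (mem_negSpace.1 hy) hsv) hqy
  · obtain ⟨a, ha, hqa⟩ := exists_mem_anisotropic (mem_bot_of_mem_negSpace hq h2 hs hss)
      fun h => hs1 (by
        ext v
        obtain ⟨b, a, hb, ha, rfl⟩ := exists_eq_add_of_involution h2 hss v
        have : a = 0 := (Submodule.mem_bot F).1 (h (mem_negSpace.2 ha))
        simp [this, hb])
    obtain ⟨e, he, f, hf, hqe, hqf, hef⟩ := exists_orthogonal_pair h2 hrad (by omega)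
    obtain ⟨b, hb, hab⟩ := exists_mem_map_eq h2 he hf hqe hqf hef (q a)
    obtain ⟨y, hy, hqy⟩ := exists_mem_map_eq h2 he hf hqe hqf hef (2 * q b)
    exact exists_commutator_of_vectors h2 hs hsv (mem_negSpace.1 ha) (mem_fixedSpace.1 hb.1) hb.2
      (by rwa [hab]) hab.symm (Or.inl (mem_fixedSpace.1 hy.1)) hy.2 hqy

/-- An involution fixing exactly a hyperbolic plane is minus a product of two reflections. -/
theorem exists_negOne_mul_eq_of_finrank_eq_two [FiniteDimensional F V] (hq : q.Nondegenerate)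
    (h2 : (2 : F) ≠ 0) {s : V ≃ₗ[F] V} (hs : s ∈ GO q) (hss : s * s = 1) {v₀ : V}
    (hv : IsSingular q v₀) (hsv : s v₀ = v₀) (hfin : Module.finrank F (fixedSpace s) = 2) :
    ∃ e f : V, ∃ (he : q e ≠ 0) (hf : q f ≠ 0), QuadraticMap.polar q e f = 0 ∧
      (∃ r, q e * q f = -(r * r)) ∧ negOne F V * s = reflEquiv e he * reflEquiv f hf := by
  obtain ⟨e, he, f, hf, hqe, hqf, hef⟩ := exists_orthogonal_pair (q := q) (R := ⊥) h2
    (mem_bot_of_mem_fixedSpace hq h2 hs hss) (by rw [finrank_bot, hfin])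
  have hfe : QuadraticMap.polar q f e = 0 := by rw [QuadraticMap.polar_comm, hef]
  have hse := mem_fixedSpace.1 he
  have hsf := mem_fixedSpace.1 hf
  have hee : QuadraticMap.polar q e e = 2 * q e := by simp [QuadraticMap.polar_self]
  have hff : QuadraticMap.polar q f f = 2 * q f := by simp [QuadraticMap.polar_self]
  have hspan : Submodule.span F {e, f} = fixedSpace s := by
    refine Submodule.eq_of_le_of_finrank_eq (Submodule.span_le.2 ?_) ?_
    · rintro v (rfl | rfl)
      exacts [he, hf]
    · have hli : LinearIndependent F ![e, f] := by
        rw [LinearIndependent.pair_iff]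
        intro α β h
        have h1 := congrArg (QuadraticMap.polar q e) h
        have h3 := congrArg (QuadraticMap.polar q f) h
        simp only [QuadraticMap.polar_add_right, QuadraticMap.polar_smul_right, hef, hfe, hee, hff,
          smul_eq_mul, mul_zero, add_zero, zero_add, QuadraticMap.polar_zero_right] at h1 h3
        exact ⟨(mul_eq_zero.1 h1).resolve_right (mul_ne_zero h2 hqe),
          (mul_eq_zero.1 h3).resolve_right (mul_ne_zero h2 hqf)⟩
      have h := finrank_span_eq_card hli
      rw [hfin, ← Matrix.range_cons_cons_empty e f ![], h, Fintype.card_fin]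
  have hmem : ∀ v, s v = v → ∃ α β : F, α • e + β • f = v := fun v h => by
    rwa [← Submodule.mem_span_pair, hspan, mem_fixedSpace]
  refine ⟨e, f, hqe, hqf, hef, ?_, ?_⟩
  -- For $v_0 = \alpha e + \beta f$, singularity reads $\alpha^2 q(e) + \beta^2 q(f) = 0$, so $q(e)
  -- q(f) = -(\alpha q(e)/\beta)^2$.
  · obtain ⟨α, β, h⟩ := hmem v₀ hsv
    have h0 : α * α * q e + β * β * q f = 0 := by
      have := hv.2
      rwa [← h, QuadraticMap.map_add q, QuadraticMap.map_smul, QuadraticMap.map_smul,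
        QuadraticMap.polar_smul_left, QuadraticMap.polar_smul_right, hef, smul_zero, smul_zero,
        add_zero] at this
    have hβ : β ≠ 0 := by
      rintro rfl
      have hα : α = 0 := by simpa [hqe] using h0
      exact hv.1 (by rw [← h, hα, zero_smul, zero_smul, add_zero])
    refine ⟨α * q e / β, ?_⟩
    field_simp
    linear_combination h0
  · ext v
    obtain ⟨b, a, hb, ha, rfl⟩ := exists_eq_add_of_involution h2 hss v
    obtain ⟨α, β, rfl⟩ := hmem b hb
    have h1 : refl q f a = a := refl_of_polar_eq_zero (polar_fixed_neg h2 hs ha hsf)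
    have h3 : refl q e a = a := refl_of_polar_eq_zero (polar_fixed_neg h2 hs ha hse)
    have h4 : refl q e f = f := refl_of_polar_eq_zero hef
    have h5 : refl q f e = e := refl_of_polar_eq_zero hfe
    change -(s (α • e + β • f + a)) = refl q e (refl q f (α • e + β • f + a))
    simp only [map_add, map_smul, map_neg, hse, hsf, ha, h1, h3, h4, h5, refl_self hqe, refl_self hqf]
    simp only [smul_neg]
    abel

end Involutions

/-! ### Lifting the central involution; the subgroups $P(V)$ and $Q(V)$ -/

section Stabilizer

variable {F : Type*} [Field F] {V : Type*} [AddCommGroup V] [Module F V]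
  {q : QuadraticForm F V}

theorem negOne_mul_cancel_left (g : V ≃ₗ[F] V) : negOne F V * (negOne F V * g) = g := by
  rw [← mul_assoc, negOne_mul_self, one_mul]

theorem negOne_mem_GO : negOne F V ∈ GO q := fun x => q.map_neg x

theorem negOne_mem_PSub : negOne F V ∈ PSub q := Or.inr ⟨1, one_mem _, (mul_one _).symm⟩

theorem negOne_ne_one [Nontrivial V] (h2 : (2 : F) ≠ 0) : negOne F V ≠ 1 := by
  intro h
  obtain ⟨x, hx⟩ := exists_ne (0 : V)
  have h1 : -x = x := LinearEquiv.congr_fun h x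
  have h3 : (2 : F) • x = 0 := by rw [two_smul]; nth_rewrite 1 [← h1]; exact neg_add_cancel x
  exact hx ((smul_eq_zero.1 h3).resolve_left h2)

theorem Omega_le_PSub : Omega q ≤ PSub q := fun _ h => Or.inl h

theorem Omega_le_QSub : Omega q ≤ QSub q := fun _ h => Subgroup.subset_closure (Or.inl h)

theorem PSub_le_GO : PSub q ≤ GO q := by
  rintro g (h | ⟨w, hw, rfl⟩)
  · exact h.1.1
  · exact mul_mem negOne_mem_GO hw.1.1

theorem QSub_le_GO : QSub q ≤ GO q := by
  refine (Subgroup.closure_le _).2 ?_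
  rintro g (h | ⟨s, hs, -, w, hw, rfl⟩)
  · exact h.1.1
  · exact mul_mem (mul_mem negOne_mem_GO hs.1) hw.1.1

/-- An element of $Q(V)$ outside $\Omega(V)$ is $-\sigma w$ with $\sigma w \notin \Omega(V)$. If no
$\sigma$ exists, the generators of $Q(V)$ all lie in $\Omega(V)$. -/
theorem mem_Omega_or_negOne_mul_notMem_of_mem_QSub [Finite F] [FiniteDimensional F V]
    (hq : q.Nondegenerate) (h2 : (2 : F) ≠ 0) {g : V ≃ₗ[F] V} (hg : g ∈ QSub q) :
    g ∈ Omega q ∨ negOne F V * g ∉ Omega q := by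
  by_cases h : ∃ s ∈ SO q, s ∉ Omega q
  · obtain ⟨s, hs, hs'⟩ := h
    have hg' : g ∈ (QSub q : Set (V ≃ₗ[F] V)) := hg
    rw [coe_QSub hq h2 hs hs'] at hg'
    refine hg'.imp_right ?_
    rintro ⟨w, hw, rfl⟩ h
    rw [mul_assoc, negOne_mul_cancel_left] at h
    exact hs' ((Subgroup.mul_mem_cancel_right _ hw).1 h)
  · push Not at h
    refine Or.inl ((Subgroup.closure_le _).2 ?_ hg)
    rintro g (h' | ⟨s, hs, hs', -⟩)
    · exact h'
    · exact absurd (h s hs) hs'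

theorem pow_eq_self_of_mul_self_eq_one {H : Type*} [Monoid H] {p : ℕ} (hp : Odd p) {a : H}
    (ha : a * a = 1) : a ^ p = a := by
  obtain ⟨k, rfl⟩ := hp
  rw [pow_succ, pow_mul, sq, ha, one_pow, one_mul]

/-- A central involution of the quotient of a group by a normal subgroup of odd exponent `p` lifts
to an involution all of whose commutators have order dividing `p`. -/
theorem exists_involution_of_groupExtension {N E H : Type*} [Group N] [Group E] [Group H]
    (S : GroupExtension N E H) {p : ℕ} (hp : Odd p) (hN : ∀ a : N, a ^ p = 1) {z : H}
    (hz : z * z = 1) (hz1 : z ≠ 1) (hc : ∀ h, z * h = h * z) :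
    ∃ s : E, s * s = 1 ∧ s ≠ 1 ∧ ∀ h, (s * h * s⁻¹ * h⁻¹) ^ p = 1 := by
  have hker : ∀ e : E, S.rightHom e = 1 → e ^ p = 1 := by
    intro e he
    rw [← MonoidHom.mem_ker, ← S.range_inl_eq_ker_rightHom] at he
    obtain ⟨a, rfl⟩ := he
    rw [← map_pow, hN, map_one]
  obtain ⟨e, rfl⟩ := S.rightHom_surjective z
  have hpow : S.rightHom (e ^ p) = S.rightHom e := by
    rw [map_pow, pow_eq_self_of_mul_self_eq_one hp hz]
  -- For any lift $e$ of $z$, the element $e^2$ lies in the kernel, so $(e^p)^2 = (e^2)^p = 1$; and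
  -- $e^p$ still lifts $z$ because $p$ is odd.
  refine ⟨e ^ p, ?_, ?_, ?_⟩
  · rw [← (Commute.refl e).mul_pow]
    exact hker _ (by rw [map_mul, hz])
  · intro h
    rw [h, map_one] at hpow
    exact hz1 hpow.symm
  · intro h
    refine hker _ ?_
    rw [map_mul, map_mul, map_mul, map_inv, map_inv, hpow, hc, mul_inv_cancel_right,
      mul_inv_cancel]

end Stabilizer

end OrthSub

/-! ### The main theorem -/

theorem mainTheorem4 (m n p : ℕ) [Fact p.Prime] (hp : p ≠ 2) (hm : 2 ≤ m) (hn : n = 2 * m + 1)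
    (hnp : (n, p) ≠ (5, 3))
    {V : Type*} [AddCommGroup V] [Module (ZMod p) V] (q : QuadraticForm (ZMod p) V)
    (hVn : Module.finrank (ZMod p) V = n) (hq : q.Nondegenerate)
    {W : Type*} [AddCommGroup W] [Module (ZMod p) W] (q' : QuadraticForm (ZMod p) W)
    (hWn : Module.finrank (ZMod p) W = n - 2) (hq' : q'.Nondegenerate)
    (G : Subgroup (V ≃ₗ[ZMod p] V))
    (hG : G = OrthSub.SO q ∨ G = OrthSub.PSub q ∨ G = OrthSub.QSub q)
    (v₀ : V) (hv₀ : OrthSub.IsSingular q v₀)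
    (hstab : Nonempty (GroupExtension (Multiplicative (Fin (n - 2) → ZMod p))
      (MulAction.stabilizer G v₀) (OrthSub.PSub q'))) :
    (p % 4 = 1 → G = OrthSub.PSub q) ∧ (p % 4 = 3 → G = OrthSub.QSub q) := by
  obtain ⟨S⟩ := hstab
  have hpp : p.Prime := Fact.out
  have hodd : Odd p := hpp.odd_of_ne_two hp
  have h2 : (2 : ZMod p) ≠ 0 := by
    intro h
    have h' : ((2 : ℕ) : ZMod p) = 0 := by exact_mod_cast h
    rw [ZMod.natCast_eq_zero_iff] at h'
    exact hp ((Nat.prime_dvd_prime_iff_eq hpp Nat.prime_two).1 h')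
  have : FiniteDimensional (ZMod p) V := Module.finite_of_finrank_pos (by omega)
  have : Nontrivial W := Module.nontrivial_of_finrank_pos (R := ZMod p) (by omega)
  have hΩG : OrthSub.Omega q ≤ G := by
    rcases hG with rfl | rfl | rfl
    exacts [OrthSub.Omega_le_SO, OrthSub.Omega_le_PSub, OrthSub.Omega_le_QSub]
  have hGO : G ≤ OrthSub.GO q := by
    rcases hG with rfl | rfl | rfl
    exacts [inf_le_left, OrthSub.PSub_le_GO, OrthSub.QSub_le_GO]
  obtain ⟨⟨⟨s, hsG⟩, hsv⟩, hss, hs1, hcomm⟩ := OrthSub.exists_involution_of_groupExtension S hodd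
    (fun a => by
      refine Multiplicative.toAdd.injective (funext fun i => ?_)
      simp)
    (z := ⟨_, OrthSub.negOne_mem_PSub⟩) (Subtype.ext OrthSub.negOne_mul_self)
    (fun h => OrthSub.negOne_ne_one h2 (congrArg Subtype.val h))
    (fun h => Subtype.ext (OrthSub.negOne_comm _))
  have hsv' : s v₀ = v₀ := hsv
  have hss' : s * s = 1 := congrArg (fun x => x.1.1) hss
  have hs1' : s ≠ 1 := fun h => hs1 (Subtype.ext (Subtype.ext h))
  have hsGO := hGO hsG
  have hfin : Module.finrank (ZMod p) (OrthSub.fixedSpace s) = 2 := by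
    by_contra hfin
    obtain ⟨h, hh, hhv, hc2, hc1⟩ := OrthSub.exists_commutator_of_involution hq h2 (by omega) hsGO
      hss' hs1' hv₀ hsv' hfin
    have hcp : (s * h * s⁻¹ * h⁻¹) ^ p = 1 :=
      congrArg (fun x => x.1.1) (hcomm ⟨⟨h, hΩG hh⟩, hhv⟩)
    -- An element whose square and whose $p$-th power are trivial is trivial, $p$ being odd.
    exact hc1 ((OrthSub.pow_eq_self_of_mul_self_eq_one hodd hc2).symm.trans hcp)
  obtain ⟨e, f, he, hf, hef, ⟨r, hr⟩, hneg⟩ :=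
    OrthSub.exists_negOne_mul_eq_of_finrank_eq_two hq h2 hsGO hss' hv₀ hsv' hfin
  have hSO : s ∉ OrthSub.SO q := by
    intro hs
    have hmem : OrthSub.negOne (ZMod p) V * s ∈ OrthSub.SO q :=
      hneg ▸ OrthSub.reflEquiv_mul_reflEquiv_mem_SO he hf
    have hdet := (OrthSub.mem_SO_iff.1 ((Subgroup.mul_mem_cancel_right _ hs).1 hmem)).2
    have hcoe : ((OrthSub.negOne (ZMod p) V : V ≃ₗ[ZMod p] V) : V →ₗ[ZMod p] V) =
        (-1 : ZMod p) • LinearMap.id := by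
      ext x
      simp [OrthSub.negOne]
    -- If $s$ had determinant $1$, so would $-1$; but its determinant is $(-1)^n = -1$ for odd $n$.
    rw [hcoe, LinearMap.det_smul, LinearMap.det_id, mul_one, hVn, hn, pow_succ, pow_mul] at hdet
    norm_num at hdet
    exact h2 (by linear_combination -hdet)
  have hΩ : s ∉ OrthSub.Omega q := fun h => hSO (OrthSub.Omega_le_SO h)
  have hcard : Fintype.card (ZMod p) = p := ZMod.card p
  have hre : r ≠ 0 := by
    rintro rfl
    exact mul_ne_zero he hf (by rw [hr]; simp)
  refine ⟨fun h4 => ?_, fun h4 => ?_⟩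
  · rcases hG with rfl | h | rfl
    · exact absurd hsG hSO
    · exact h
    -- Here $-1$ is a square, so $q(e) q(f) = -r^2$ is one too and $-s = r_e r_f \in \Omega(V)$,
    -- which $Q(V)$ does not allow.
    · refine absurd ?_ ((OrthSub.mem_Omega_or_negOne_mul_notMem_of_mem_QSub hq h2 hsG).resolve_left
        hΩ)
      rw [hneg]
      refine OrthSub.reflEquiv_mul_reflEquiv_mem_Omega he hf ?_
      have h1 : IsSquare (-1 : ZMod p) := by
        rw [FiniteField.isSquare_neg_one_iff, hcard]
        omega
      rw [hr, neg_eq_neg_one_mul]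
      exact h1.mul (IsSquare.mul_self r)
  · rcases hG with rfl | rfl | h
    · exact absurd hsG hSO
    -- Membership in $P(V)$ would force $-s = r_e r_f \in \Omega(V)$, although $-r^2$ is a
    -- nonsquare.
    · obtain ⟨w, hw, hsw⟩ := hsG.resolve_left hΩ
      rw [hsw, OrthSub.negOne_mul_cancel_left] at hneg
      refine absurd (hneg ▸ hw)
        (OrthSub.reflEquiv_mul_reflEquiv_notMem_Omega hq h2 (by omega) he hf hef ?_)
      rintro ⟨t, ht⟩
      have h1 : IsSquare (-1 : ZMod p) := by
        refine ⟨t / r, ?_⟩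
        field_simp
        linear_combination ht - hr
      rw [FiniteField.isSquare_neg_one_iff, hcard] at h1
      exact h1 h4
    · exact h
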